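/- Let $\mathcal S=\{(x,y)\in\mathbb R^2 : 0<y<1\}$, let $\Omega\subset\mathbb R^2$ be an open set with $\Omega\subset\mathcal S$ (for instance a connected Lipschitz waveguide that coincides with $\mathcal S$ outside a bounded region), and let $k\in(0,\pi)$. All functions are real valued. Let $H^1(\Omega)$ be the Hilbert space of functions $u\in L^2(\Omega)$ whose weak gradient $\nabla u$ belongs to $L^2(\Omega)^2$, with inner product $(u,v)_{H^1(\Omega)}=\int_\Omega \nabla u\cdot\nabla v+uv\,dxdy$, and let $H^1_0(\Omega)$ be the closure of $C^\infty_c(\Omega)$ in $H^1(\Omega)$. Put $$a(u,v)=\int_\Omega \nabla u\cdot\nabla v-k^2uv\,dxdy,\qquad u,v\in H^1_0(\Omega),$$ and let $A(k):H^1_0(\Omega)\to H^1_0(\Omega)$ be the bounded linear operator given by the Riesz theorem through $(A(k)u,v)_{H^1(\Omega)}=a(u,v)$ for all $u,v\in H^1_0(\Omega)$. Then $A(k)$ is injective and is an isomorphism of $H^1_0(\Omega)$ (a linear bijection with bounded inverse). Moreover, for every $f\in L^2(\Omega)$ there is exactly one $u\in H^1_0(\Omega)$ such that $$a(u,v)=\int_\Omega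 fv\,dxdy\qquad\text{for all } v\in H^1_0(\Omega).$$ -/

import Mathlib

open MeasureTheory TopologicalSpace
open scoped Distributions InnerProductSpace

noncomputable section

namespace Waveguide

/-- The plane `ℝ²` with its Euclidean norm; the coordinates of `p` are `p 0` and `p 1`. -/
abbrev Plane : Type := EuclideanSpace ℝ (Fin 2)

/-- The reference strip `ℝ × (0, 1)`. -/
def strip : Set Plane := {p | p 1 ∈ Set.Ioo (0 : ℝ) 1}

/-- The real Lebesgue space `L²(Ω)`. -/
abbrev L2 (Ω : Opens Plane) : Type := Lp ℝ 2 (volume.restrict (Ω : Set Plane))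

/-- The space `L²(Ω)²` of square-integrable vector fields. -/
abbrev L2Vec (Ω : Opens Plane) : Type := Lp Plane 2 (volume.restrict (Ω : Set Plane))

/-- The partial derivative `∂ᵢ φ`. -/
def partialDeriv (i : Fin 2) (φ : Plane → ℝ) (x : Plane) : ℝ :=
  fderiv ℝ φ x (EuclideanSpace.single i 1)

/-- `g` is the gradient of `u` on `Ω` in the sense of distributions:
`∫ u ∂ᵢφ = - ∫ gᵢ φ` for every `φ ∈ C_c^∞(Ω)` and every coordinate `i`. -/
def IsWeakGradient (Ω : Opens Plane) (u : Plane → ℝ) (g : Plane → Plane) : Prop :=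
  ∀ (φ : 𝓓(Ω, ℝ)) (i : Fin 2),
    ∫ x in (Ω : Set Plane), u x * partialDeriv i φ x = - ∫ x in (Ω : Set Plane), g x i * φ x

/-! Facts on test functions. -/

lemma partialDeriv_continuous {Ω : Opens Plane} (φ : 𝓓(Ω, ℝ)) (i : Fin 2) :
    Continuous (partialDeriv i φ) :=
  (φ.contDiff.continuous_fderiv (by simp)).clm_apply continuous_const

lemma partialDeriv_hasCompactSupport {Ω : Opens Plane} (φ : 𝓓(Ω, ℝ)) (i : Fin 2) :
    HasCompactSupport (partialDeriv i φ) :=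
  φ.hasCompactSupport.fderiv_apply ℝ _

/-- The classical gradient `(∂₀ φ, ∂₁ φ)`. -/
def classicalGrad (φ : Plane → ℝ) (x : Plane) : Plane :=
  WithLp.toLp 2 fun i => partialDeriv i φ x

lemma memLp_test {Ω : Opens Plane} (φ : 𝓓(Ω, ℝ)) :
    MemLp φ 2 (volume.restrict (Ω : Set Plane)) :=
  (φ.continuous.memLp_of_hasCompactSupport φ.hasCompactSupport).restrict _

lemma memLp_partialDeriv {Ω : Opens Plane} (φ : 𝓓(Ω, ℝ)) (i : Fin 2) :
    MemLp (partialDeriv i φ) 2 (volume.restrict (Ω : Set Plane)) :=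
  ((partialDeriv_continuous φ i).memLp_of_hasCompactSupport
    (partialDeriv_hasCompactSupport φ i)).restrict _

lemma memLp_classicalGrad {Ω : Opens Plane} (φ : 𝓓(Ω, ℝ)) :
    MemLp (classicalGrad φ) 2 (volume.restrict (Ω : Set Plane)) := by
  have hc : Continuous (classicalGrad φ) := by
    refine (PiLp.continuous_toLp 2 _).comp ?_
    exact continuous_pi fun i => partialDeriv_continuous φ i
  refine (hc.memLp_of_hasCompactSupport ?_).restrict _
  refine φ.hasCompactSupport.fderiv (𝕜 := ℝ) |>.mono ?_
  intro x hx hx'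
  apply hx
  ext i
  simp [classicalGrad, partialDeriv, show fderiv ℝ φ x = 0 from hx']

lemma integrable_mul_test {Ω : Opens Plane} {u : Plane → ℝ}
    (hu : MemLp u 2 (volume.restrict (Ω : Set Plane))) (φ : 𝓓(Ω, ℝ)) :
    Integrable (fun x => u x * φ x) (volume.restrict (Ω : Set Plane)) :=
  hu.integrable_mul (memLp_test φ)

lemma integrable_mul_partialDeriv {Ω : Opens Plane} {u : Plane → ℝ}
    (hu : MemLp u 2 (volume.restrict (Ω : Set Plane))) (φ : 𝓓(Ω, ℝ)) (i : Fin 2) :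
    Integrable (fun x => u x * partialDeriv i φ x) (volume.restrict (Ω : Set Plane)) :=
  hu.integrable_mul (memLp_partialDeriv φ i)

lemma memLp_coord {Ω : Opens Plane} {g : Plane → Plane}
    (hg : MemLp g 2 (volume.restrict (Ω : Set Plane))) (i : Fin 2) :
    MemLp (fun x => g x i) 2 (volume.restrict (Ω : Set Plane)) :=
  hg.continuousLinearMap_comp (EuclideanSpace.proj (𝕜 := ℝ) i)

lemma IsWeakGradient.congr {Ω : Opens Plane} {u u' : Plane → ℝ} {g g' : Plane → Plane}
    (h : IsWeakGradient Ω u g) (hu : u' =ᵐ[volume.restrict (Ω : Set Plane)] u)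
    (hg : g' =ᵐ[volume.restrict (Ω : Set Plane)] g) : IsWeakGradient Ω u' g' := by
  intro φ i
  rw [integral_congr_ae (g := fun x => u x * partialDeriv i φ x)
      (by filter_upwards [hu] with x hx; rw [hx]),
    integral_congr_ae (f := fun x => g' x i * φ x) (g := fun x => g x i * φ x)
      (by filter_upwards [hg] with x hx; rw [hx])]
  exact h φ i

/-- The classical gradient of a test function is its weak gradient. -/
lemma isWeakGradient_test {Ω : Opens Plane} (ψ : 𝓓(Ω, ℝ)) :
    IsWeakGradient Ω ψ (classicalGrad ψ) := by
  intro φ i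
  have hψ : ∀ x, x ∉ (Ω : Set Plane) → ψ x = 0 := fun x hx =>
    image_eq_zero_of_notMem_tsupport fun h => hx (ψ.tsupport_subset h)
  have hφ : ∀ x, x ∉ (Ω : Set Plane) → φ x = 0 := fun x hx =>
    image_eq_zero_of_notMem_tsupport fun h => hx (φ.tsupport_subset h)
  rw [setIntegral_eq_integral_of_forall_compl_eq_zero (by intro x hx; simp [hψ x hx]),
    setIntegral_eq_integral_of_forall_compl_eq_zero (by intro x hx; simp [hφ x hx])]
  have hdψ := partialDeriv_continuous ψ i
  have hdφ := partialDeriv_continuous φ i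
  exact integral_mul_fderiv_eq_neg_fderiv_mul_of_integrable
    ((hdψ.mul φ.continuous).integrable_of_hasCompactSupport φ.hasCompactSupport.mul_left)
    ((ψ.continuous.mul hdφ).integrable_of_hasCompactSupport ψ.hasCompactSupport.mul_right)
    ((ψ.continuous.mul φ.continuous).integrable_of_hasCompactSupport φ.hasCompactSupport.mul_left)
    (fun x _ => (ψ.contDiff.differentiable (by simp)).differentiableAt)
    (fun x _ => (φ.contDiff.differentiable (by simp)).differentiableAt)

/-! The Sobolev spaces. -/

/-- The graph of the weak gradient: the pairs `(u, ∇u)` with `u ∈ L²(Ω)` whose weak gradient `∇u`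
is in `L²(Ω)²`. -/
def H1Graph (Ω : Opens Plane) : Submodule ℝ (WithLp 2 (L2 Ω × L2Vec Ω)) where
  carrier := {w | IsWeakGradient Ω w.fst w.snd}
  add_mem' := by
    intro a b ha hb
    refine IsWeakGradient.congr (u := fun x => a.fst x + b.fst x) (g := fun x => a.snd x + b.snd x)
      ?_ (Lp.coeFn_add a.fst b.fst) (Lp.coeFn_add a.snd b.snd)
    intro φ i
    have e1 := integral_add (integrable_mul_partialDeriv (Lp.memLp a.fst) φ i)
      (integrable_mul_partialDeriv (Lp.memLp b.fst) φ i)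
    have e2 := integral_add (integrable_mul_test (memLp_coord (Lp.memLp a.snd) i) φ)
      (integrable_mul_test (memLp_coord (Lp.memLp b.snd) i) φ)
    simp only [add_mul, PiLp.add_apply]
    rw [e1, e2, ha φ i, hb φ i]
    ring
  zero_mem' := by
    refine IsWeakGradient.congr (u := fun _ => 0) (g := fun _ => 0) ?_
      (Lp.coeFn_zero ℝ 2 (volume.restrict (Ω : Set Plane)))
      (Lp.coeFn_zero Plane 2 (volume.restrict (Ω : Set Plane)))
    intro φ i
    simp
  smul_mem' := by
    intro c a ha
    refine IsWeakGradient.congr (u := fun x => c * a.fst x) (g := fun x => c • a.snd x)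
      ?_ (Lp.coeFn_smul c a.fst) (Lp.coeFn_smul c a.snd)
    intro φ i
    simp only [PiLp.smul_apply, smul_eq_mul, mul_assoc, integral_const_mul]
    rw [ha φ i]
    ring

lemma isClosed_H1Graph (Ω : Opens Plane) :
    IsClosed (H1Graph Ω : Set (WithLp 2 (L2 Ω × L2Vec Ω))) := by
  have e : (H1Graph Ω : Set (WithLp 2 (L2 Ω × L2Vec Ω))) = ⋂ (φ : 𝓓(Ω, ℝ)) (i : Fin 2),
      {w | ⟪(memLp_partialDeriv φ i).toLp _, w.fst⟫_ℝ = - ⟪(memLp_test φ).toLp _,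
        (EuclideanSpace.proj (𝕜 := ℝ) i).compLp w.snd⟫_ℝ} := by
    ext w
    simp only [SetLike.mem_coe, Set.mem_iInter, Set.mem_ofPred_eq]
    refine forall_congr' fun φ => forall_congr' fun i => ?_
    rw [L2.inner_def, L2.inner_def]
    rw [integral_congr_ae (f := fun x => ⟪(memLp_partialDeriv φ i).toLp _ x, w.fst x⟫_ℝ)
        (g := fun x => w.fst x * partialDeriv i φ x)
        (by filter_upwards [(memLp_partialDeriv φ i).coeFn_toLp] with x hx
            rw [hx]; simp),
      integral_congr_ae (f := fun x => ⟪(memLp_test φ).toLp _ x,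
          (EuclideanSpace.proj (𝕜 := ℝ) i).compLp w.snd x⟫_ℝ)
        (g := fun x => w.snd x i * φ x)
        (by filter_upwards [(memLp_test φ).coeFn_toLp,
              (EuclideanSpace.proj (𝕜 := ℝ) i).coeFn_compLp w.snd] with x hx hx'
            rw [hx, hx']; simp)]
  rw [e]
  refine isClosed_iInter fun φ => isClosed_iInter fun i => isClosed_eq ?_ ?_
  · exact continuous_const.inner (WithLp.fstL 2 ℝ (L2 Ω) (L2Vec Ω)).continuous
  · exact (continuous_const.inner
      (((EuclideanSpace.proj (𝕜 := ℝ) i).compLpL 2 (volume.restrict (Ω : Set Plane))).continuous.comp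
        (WithLp.sndL 2 ℝ (L2 Ω) (L2Vec Ω)).continuous)).neg

/-- The Sobolev space `H¹(Ω)`: the functions `u ∈ L²(Ω)` whose weak gradient is in `L²(Ω)²`. An
element is stored together with its weak gradient as a point `(u, ∇u)` of the Hilbert space
`L²(Ω) × L²(Ω)²`, so that the inherited inner product is `∫ ∇u · ∇v + u v` (see `H1.inner_eq`);
the weak gradient is determined by `u` (see `H1.toL2_injective`). -/
def H1 (Ω : Opens Plane) : Type := H1Graph Ω

instance (Ω : Opens Plane) : NormedAddCommGroup (H1 Ω) :=
  inferInstanceAs (NormedAddCommGroup (H1Graph Ω))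

instance (Ω : Opens Plane) : InnerProductSpace ℝ (H1 Ω) :=
  inferInstanceAs (InnerProductSpace ℝ (H1Graph Ω))

instance (Ω : Opens Plane) : CompleteSpace (H1 Ω) :=
  (isClosed_H1Graph Ω).completeSpace_coe

/-- The function `u ∈ L²(Ω)` underlying an element of `H¹(Ω)`. -/
def H1.toL2 {Ω : Opens Plane} : H1 Ω →L[ℝ] L2 Ω :=
  (WithLp.fstL 2 ℝ (L2 Ω) (L2Vec Ω)).comp (H1Graph Ω).subtypeL

/-- The weak gradient `∇u ∈ L²(Ω)²` of an element of `H¹(Ω)`. -/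
def H1.grad {Ω : Opens Plane} : H1 Ω →L[ℝ] L2Vec Ω :=
  (WithLp.sndL 2 ℝ (L2 Ω) (L2Vec Ω)).comp (H1Graph Ω).subtypeL

lemma H1.isWeakGradient {Ω : Opens Plane} (u : H1 Ω) :
    IsWeakGradient Ω (H1.toL2 u) (H1.grad u) := u.2

/-- An element of `H¹(Ω)` is determined by its underlying function. -/
lemma H1.toL2_injective {Ω : Opens Plane} : Function.Injective (H1.toL2 (Ω := Ω)) := by
  rw [injective_iff_map_eq_zero]
  intro u hu
  have hg : H1.grad u = 0 := by
    have key : ∀ i : Fin 2, ∀ᵐ x ∂(volume : Measure Plane),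
        x ∈ (Ω : Set Plane) → H1.grad u x i = 0 := by
      intro i
      have hm := memLp_coord (Lp.memLp (H1.grad u)) i
      refine Ω.isOpen.ae_eq_zero_of_integral_contDiff_smul_eq_zero
        (f := fun x => H1.grad u x i) ?_ ?_
      · rw [locallyIntegrableOn_iff Ω.isOpen.isLocallyClosed]
        intro K hK hKc
        have h2 : MemLp (fun x => H1.grad u x i) 2 (volume.restrict K) :=
          hm.mono_measure (Measure.restrict_mono hK le_rfl)
        have : IsFiniteMeasure ((volume : Measure Plane).restrict K) :=
          ⟨by simpa using hKc.measure_lt_top⟩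
        exact h2.integrable (by norm_num)
      · intro g hg1 hg2 hg3
        have h := H1.isWeakGradient u ⟨g, hg1, hg2, hg3⟩ i
        rw [hu, integral_congr_ae (g := fun _ => (0 : ℝ)) (by
          filter_upwards [Lp.coeFn_zero ℝ 2 (volume.restrict (Ω : Set Plane))] with x hx
          have hx0 : (0 : L2 Ω) x = 0 := hx
          rw [hx0, zero_mul])] at h
        simp only [integral_zero, TestFunction.coe_mk] at h
        rw [← setIntegral_eq_integral_of_forall_compl_eq_zero (s := (Ω : Set Plane)) (by
          intro x hx
          simp [image_eq_zero_of_notMem_tsupport fun h' => hx (hg3 h')])]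
        simp only [smul_eq_mul, mul_comm (g _)]
        linarith
    refine (Lp.eq_zero_iff_ae_eq_zero).2 ?_
    rw [Filter.EventuallyEq, ae_restrict_iff' Ω.isOpen.measurableSet]
    filter_upwards [key 0, key 1] with x h0 h1 hx
    ext i
    fin_cases i
    · exact h0 hx
    · exact h1 hx
  apply Subtype.ext
  apply (WithLp.equiv 2 _).injective
  exact Prod.ext hu hg

/-- The inner product of `H¹(Ω)` is `∫ ∇u · ∇v + u v`. -/
lemma H1.inner_eq {Ω : Opens Plane} (u v : H1 Ω) :
    ⟪u, v⟫_ℝ = ∫ x in (Ω : Set Plane),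
      (⟪H1.grad u x, H1.grad v x⟫_ℝ + H1.toL2 u x * H1.toL2 v x) := by
  have h1 := L2.integrable_inner (𝕜 := ℝ) (H1.grad u) (H1.grad v)
  have h2 := L2.integrable_inner (𝕜 := ℝ) (H1.toL2 u) (H1.toL2 v)
  have e : ⟪u, v⟫_ℝ = ⟪H1.toL2 u, H1.toL2 v⟫_ℝ + ⟪H1.grad u, H1.grad v⟫_ℝ := rfl
  rw [e, L2.inner_def, L2.inner_def, add_comm, ← integral_add h1 h2]
  simp [mul_comm]

/-- A test function `φ ∈ C_c^∞(Ω)` as an element of `H¹(Ω)`. -/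
def H1.ofTest {Ω : Opens Plane} (φ : 𝓓(Ω, ℝ)) : H1 Ω :=
  ⟨WithLp.toLp 2 ((memLp_test φ).toLp φ, (memLp_classicalGrad φ).toLp (classicalGrad φ)),
    (isWeakGradient_test φ).congr (memLp_test φ).coeFn_toLp (memLp_classicalGrad φ).coeFn_toLp⟩

/-- `H¹₀(Ω)`, the closure in `H¹(Ω)` of (the linear subspace) `C_c^∞(Ω)`. -/
def H10 (Ω : Opens Plane) : Submodule ℝ (H1 Ω) :=
  (Submodule.span ℝ (Set.range (H1.ofTest (Ω := Ω)))).topologicalClosure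

instance (Ω : Opens Plane) : CompleteSpace (H10 Ω) :=
  (Submodule.isClosed_topologicalClosure _).completeSpace_coe

/-! The variational problem and its operator. -/

/-- The bilinear form `a(u, v) = ∫_Ω ∇u · ∇v - k² u v` on `H¹₀(Ω)`. -/
def form {Ω : Opens Plane} (k : ℝ) (u v : H10 Ω) : ℝ :=
  ∫ x in (Ω : Set Plane), (⟪H1.grad u.1 x, H1.grad v.1 x⟫_ℝ
    - k ^ 2 * (H1.toL2 u.1 x * H1.toL2 v.1 x))

/-- The linear form `ℓ(v) = ∫_Ω f v` on `H¹₀(Ω)`. -/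
def load {Ω : Opens Plane} (f : L2 Ω) (v : H10 Ω) : ℝ :=
  ∫ x in (Ω : Set Plane), f x * H1.toL2 v.1 x

/-- The form `a` as a bounded bilinear form. -/
def formL (Ω : Opens Plane) (k : ℝ) : H10 Ω →L[ℝ] H10 Ω →L[ℝ] ℝ :=
  (innerSL ℝ).bilinearComp (H1.grad.comp (H10 Ω).subtypeL) (H1.grad.comp (H10 Ω).subtypeL)
    - k ^ 2 • (innerSL ℝ).bilinearComp
        (H1.toL2.comp (H10 Ω).subtypeL) (H1.toL2.comp (H10 Ω).subtypeL)

lemma formL_apply {Ω : Opens Plane} (k : ℝ) (u v : H10 Ω) : formL Ω k u v = form k u v := by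
  have h1 := L2.integrable_inner (𝕜 := ℝ) (H1.grad u.1) (H1.grad v.1)
  have h2 := L2.integrable_inner (𝕜 := ℝ) (H1.toL2 u.1) (H1.toL2 v.1)
  have e : formL Ω k u v
      = ⟪H1.grad u.1, H1.grad v.1⟫_ℝ - k ^ 2 * ⟪H1.toL2 u.1, H1.toL2 v.1⟫_ℝ := rfl
  rw [e, L2.inner_def, L2.inner_def, ← integral_const_mul, ← integral_sub h1 (h2.const_mul _)]
  simp [form, mul_comm]

/-- The bounded operator `A(k)` of `H¹₀(Ω)` that represents the form `a` through the Riesz theorem: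
`(A(k)u, v)_{H¹(Ω)} = a(u, v)`, see `inner_A`. -/
def A (Ω : Opens Plane) (k : ℝ) : H10 Ω →L[ℝ] H10 Ω :=
  InnerProductSpace.continuousLinearMapOfBilin (𝕜 := ℝ) (formL Ω k)

lemma inner_A {Ω : Opens Plane} (k : ℝ) (u v : H10 Ω) : ⟪A Ω k u, v⟫_ℝ = form k u v := by
  rw [A, InnerProductSpace.continuousLinearMapOfBilin_apply]
  exact formL_apply k u v

end Waveguide

end

/-! ### Poincaré inequality for test functions -/

noncomputable section

namespace Waveguide

/-! The form is coercive on `H10 Ω`, so Lax–Milgram makes `A Ω k` an isomorphism, and the source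
problem becomes `A u = F` with `F` the Riesz representative of the load. Coercivity comes from the
sharp Poincaré inequality `π²‖u‖² ≤ ‖∇u‖²` (`poincare`) and `k < π`.

The sharp constant needs no spectral theory or slicing. With `w = π cot(πy)`, the Riccati equation
gives `(∂₁φ)² - π²φ² - ∂₁(wφ²) = (∂₁φ - wφ)² ≥ 0`, and the divergence term integrates to zero
because `φ` has compact support in `Ω`, away from the poles of `w` (`poincare_test`). Density then
carries the inequality to `H10 Ω`. -/

/-- The weight `π cot(π y)`, a solution of the Riccati equation `w' = -π² - w²` on `(0, 1)`. -/
def cotWeight (y : ℝ) : ℝ := Real.pi * (Real.cos (Real.pi * y) / Real.sin (Real.pi * y))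

lemma sin_pi_mul_ne_zero {y : ℝ} (hy : y ∈ Set.Ioo (0 : ℝ) 1) : Real.sin (Real.pi * y) ≠ 0 :=
  (Real.sin_pos_of_pos_of_lt_pi (mul_pos Real.pi_pos hy.1)
    (by nlinarith [Real.pi_pos, hy.2])).ne'

lemma hasDerivAt_cotWeight {y : ℝ} (hy : y ∈ Set.Ioo (0 : ℝ) 1) :
    HasDerivAt cotWeight (-Real.pi ^ 2 - cotWeight y ^ 2) y := by
  have hs := sin_pi_mul_ne_zero hy
  have hl : HasDerivAt (fun t : ℝ => Real.pi * t) Real.pi y := by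
    simpa using (hasDerivAt_id y).const_mul Real.pi
  have h := ((hl.cos.div hl.sin hs).const_mul Real.pi)
  refine h.congr_deriv ?_
  unfold cotWeight
  field_simp

/-- A function that is `Cⁿ` at every point of its support is `Cⁿ`. -/
lemma contDiff_of_forall_mem_tsupport {E : Type*} [NormedAddCommGroup E] [NormedSpace ℝ E]
    {G : E → ℝ} {n : WithTop ℕ∞} (h : ∀ x ∈ tsupport G, ContDiffAt ℝ n G x) :
    ContDiff ℝ n G := by
  rw [contDiff_iff_contDiffAt]
  intro x
  by_cases hx : x ∈ tsupport G
  · exact h x hx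
  · exact contDiffAt_const.congr_of_eventuallyEq (notMem_tsupport_iff_eventuallyEq.1 hx)

/-- The integral of a directional derivative of a compactly supported `C¹` function vanishes. -/
lemma integral_fderiv_apply_eq_zero {G : Plane → ℝ} (hG : ContDiff ℝ 1 G)
    (hc : HasCompactSupport G) (v : Plane) : ∫ x, fderiv ℝ G x v = 0 := by
  have hi : Integrable (fun x => fderiv ℝ G x v) :=
    ((hG.continuous_fderiv (by simp)).clm_apply continuous_const).integrable_of_hasCompactSupport
      (hc.fderiv_apply ℝ v)
  -- Integration by parts against the constant function `1`.
  have h := integral_mul_fderiv_eq_neg_fderiv_mul_of_integrable (μ := (volume : Measure Plane))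
    (f := fun _ : Plane => (1 : ℝ)) (g := G) (v := v) (by simp) (by simpa using hi)
    (by simpa using hG.continuous.integrable_of_hasCompactSupport hc)
    (fun x _ => differentiableAt_const _)
    (fun x _ => (hG.differentiable (by simp)).differentiableAt)
  simpa using h

/-- The Poincaré inequality in the strip, with the sharp constant, for test functions. -/
lemma poincare_test {Ω : Opens Plane} (hΩ : (Ω : Set Plane) ⊆ strip) (φ : 𝓓(Ω, ℝ)) :
    Real.pi ^ 2 * ∫ x, φ x ^ 2 ≤ ∫ x, partialDeriv 1 φ x ^ 2 := by
  set G : Plane → ℝ := fun p => cotWeight (p 1) * φ p ^ 2 with hGdef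
  have hsub : tsupport G ⊆ tsupport φ := by
    refine closure_mono fun x hx hx' => hx ?_
    simp [hGdef, hx']
  have hGc : HasCompactSupport G := φ.hasCompactSupport.of_isClosed_subset (isClosed_tsupport _) hsub
  have hφd : ∀ x, DifferentiableAt ℝ φ x := fun x =>
    (φ.contDiff.differentiable (by simp)).differentiableAt
  have hp : ∀ x : Plane, HasFDerivAt (fun p : Plane => p 1)
      (EuclideanSpace.proj (𝕜 := ℝ) (1 : Fin 2)) x := fun x =>
    (EuclideanSpace.proj (𝕜 := ℝ) (1 : Fin 2)).hasFDerivAt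
  have hG : ContDiff ℝ 1 G := by
    -- `w` is singular on the lines `y = 0, 1`, but the support of `G` lies in that of `φ`, hence
    -- inside the open strip, where `sin(πy) ≠ 0`.
    refine contDiff_of_forall_mem_tsupport fun x hx => ?_
    have hs := sin_pi_mul_ne_zero (hΩ (φ.tsupport_subset (hsub hx)))
    have hp' : ContDiffAt ℝ 1 (fun p : Plane => Real.pi * p 1) x :=
      contDiffAt_const.mul (EuclideanSpace.proj (𝕜 := ℝ) (1 : Fin 2)).contDiff.contDiffAt
    exact (contDiffAt_const.mul (hp'.cos.div hp'.sin hs)).mul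
      ((φ.contDiff.contDiffAt.of_le (by simp)).pow 2)
  have key : ∀ x, fderiv ℝ G x (EuclideanSpace.single 1 1)
      ≤ partialDeriv 1 φ x ^ 2 - Real.pi ^ 2 * φ x ^ 2 := by
    intro x
    by_cases hx : x ∈ tsupport φ
    · have hw := (hasDerivAt_cotWeight (hΩ (φ.tsupport_subset hx))).comp_hasFDerivAt x (hp x)
      have hd := hw.mul ((hφd x).hasFDerivAt.pow 2)
      have he : fderiv ℝ G x (EuclideanSpace.single 1 1)
          = 2 * cotWeight (x 1) * φ x * partialDeriv 1 φ x
            + (-Real.pi ^ 2 - cotWeight (x 1) ^ 2) * φ x ^ 2 := by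
        rw [show fderiv ℝ G x = _ from hd.fderiv]
        simp [partialDeriv]
        ring
      rw [he]
      -- The right side minus the left side is exactly this square.
      nlinarith [sq_nonneg (partialDeriv 1 φ x - cotWeight (x 1) * φ x)]
    · have h0 : fderiv ℝ G x = 0 :=
        image_eq_zero_of_notMem_tsupport fun h => hx (hsub (tsupport_fderiv_subset ℝ h))
      rw [h0, image_eq_zero_of_notMem_tsupport hx]
      simpa using sq_nonneg _
  have i1 : Integrable (fun x => partialDeriv 1 φ x ^ 2) :=
    ((partialDeriv_continuous φ 1).memLp_of_hasCompactSupport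
      (partialDeriv_hasCompactSupport φ 1) (p := 2)).integrable_sq
  have i2 : Integrable (fun x => φ x ^ 2) :=
    (φ.continuous.memLp_of_hasCompactSupport φ.hasCompactSupport (p := 2)).integrable_sq
  have i3 : Integrable (fun x => fderiv ℝ G x (EuclideanSpace.single 1 1)) :=
    ((hG.continuous_fderiv (by simp)).clm_apply continuous_const).integrable_of_hasCompactSupport
      (hGc.fderiv_apply ℝ _)
  have h := integral_mono i3 (i1.sub (i2.const_mul _)) key
  rw [integral_fderiv_apply_eq_zero hG hGc] at h
  simp only [Pi.sub_apply] at h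
  rw [integral_sub i1 (i2.const_mul _), integral_const_mul] at h
  linarith

/-! ### Passage to `H10 Ω` by density -/

lemma norm_toL2_ofTest_sq {Ω : Opens Plane} (φ : 𝓓(Ω, ℝ)) :
    ‖H1.toL2 (H1.ofTest φ)‖ ^ 2 = ∫ x, φ x ^ 2 := by
  rw [← real_inner_self_eq_norm_sq, L2.inner_def,
    ← setIntegral_eq_integral_of_forall_compl_eq_zero (s := (Ω : Set Plane))
      (f := fun x => φ x ^ 2) (by
      intro x hx
      simp [image_eq_zero_of_notMem_tsupport fun h => hx (φ.tsupport_subset h)])]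
  refine integral_congr_ae ?_
  filter_upwards [(memLp_test φ).coeFn_toLp] with x hx
  rw [show (H1.toL2 (H1.ofTest φ)) x = φ x from hx]
  simp [sq]

/-- One coordinate of the gradient is pointwise at most its Euclidean norm; only `i = 1`, the
direction across the strip, is needed later. -/
lemma integral_partialDeriv_sq_le {Ω : Opens Plane} (φ : 𝓓(Ω, ℝ)) (i : Fin 2) :
    ∫ x, partialDeriv i φ x ^ 2 ≤ ‖H1.grad (H1.ofTest φ)‖ ^ 2 := by
  rw [← real_inner_self_eq_norm_sq, L2.inner_def,
    ← setIntegral_eq_integral_of_forall_compl_eq_zero (s := (Ω : Set Plane)) (by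
      intro x hx
      have h0 : fderiv ℝ φ x = 0 := image_eq_zero_of_notMem_tsupport fun h =>
        hx (φ.tsupport_subset (tsupport_fderiv_subset ℝ h))
      simp [partialDeriv, h0])]
  refine integral_mono_ae (memLp_partialDeriv φ i).integrable_sq
    (L2.integrable_inner (𝕜 := ℝ) _ _) ?_
  filter_upwards [(memLp_classicalGrad φ).coeFn_toLp] with x hx
  rw [show (H1.grad (H1.ofTest φ)) x = classicalGrad φ x from hx]
  have h := PiLp.norm_apply_le (classicalGrad φ x) i
  rw [real_inner_self_eq_norm_sq]
  calc partialDeriv i φ x ^ 2 = ‖classicalGrad φ x i‖ ^ 2 := by simp [classicalGrad]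
    _ ≤ _ := by gcongr

/-- Every element of the span of the test functions is a test function. -/
lemma exists_ofTest_of_mem_span {Ω : Opens Plane} {u : H1 Ω}
    (hu : u ∈ Submodule.span ℝ (Set.range (H1.ofTest (Ω := Ω)))) : ∃ φ, H1.ofTest φ = u := by
  induction hu using Submodule.span_induction with
  | mem u h => exact h
  | zero =>
    -- Since the function determines its weak gradient, it suffices here and below to compare the
    -- `L²` components.
    refine ⟨0, H1.toL2_injective ?_⟩
    rw [map_zero]
    exact MemLp.toLp_zero (memLp_test (0 : 𝓓(Ω, ℝ)))
  | add u v _ _ hu hv =>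
    obtain ⟨φ, rfl⟩ := hu
    obtain ⟨ψ, rfl⟩ := hv
    refine ⟨φ + ψ, H1.toL2_injective ?_⟩
    rw [map_add]
    exact MemLp.toLp_add (memLp_test φ) (memLp_test ψ)
  | smul c u _ hu =>
    obtain ⟨φ, rfl⟩ := hu
    refine ⟨c • φ, H1.toL2_injective ?_⟩
    rw [map_smul]
    exact MemLp.toLp_const_smul c (memLp_test φ)

/-- The Poincaré inequality in `H¹₀(Ω)` for `Ω` in the strip. -/
lemma poincare {Ω : Opens Plane} (hΩ : (Ω : Set Plane) ⊆ strip) (u : H10 Ω) :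
    Real.pi ^ 2 * ‖H1.toL2 u.1‖ ^ 2 ≤ ‖H1.grad u.1‖ ^ 2 := by
  -- Both sides are continuous in the `H¹` norm, so the inequality passes to the closure of the test
  -- functions.
  have hc : IsClosed {u : H1 Ω | Real.pi ^ 2 * ‖H1.toL2 u‖ ^ 2 ≤ ‖H1.grad u‖ ^ 2} :=
    isClosed_le (continuous_const.mul (H1.toL2.continuous.norm.pow 2))
      (H1.grad.continuous.norm.pow 2)
  refine closure_minimal ?_ hc u.2
  intro v hv
  obtain ⟨φ, rfl⟩ := exists_ofTest_of_mem_span hv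
  rw [Set.mem_ofPred_eq, norm_toL2_ofTest_sq]
  exact (poincare_test hΩ φ).trans (integral_partialDeriv_sq_le φ 1)

/-! ### Coercivity and Lax–Milgram -/

lemma isCoercive_formL {Ω : Opens Plane} (hΩ : (Ω : Set Plane) ⊆ strip) {k : ℝ}
    (hk : k ∈ Set.Ioo 0 Real.pi) : IsCoercive (formL Ω k) := by
  have hkπ : k ^ 2 < Real.pi ^ 2 := pow_lt_pow_left₀ hk.2 hk.1.le two_ne_zero
  -- With `L = ‖u‖²` and `G = ‖∇u‖²` in `L²`, this constant `c` satisfies `(1 + π²)(G - k²L - c(L +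
  -- G)) = (1 + k²)(G - π²L)`, which is nonnegative by Poincaré.
  refine ⟨(Real.pi ^ 2 - k ^ 2) / (1 + Real.pi ^ 2), div_pos (by linarith) (by positivity),
    fun u => ?_⟩
  have e : formL Ω k u u = ⟪H1.grad u.1, H1.grad u.1⟫_ℝ - k ^ 2 * ⟪H1.toL2 u.1, H1.toL2 u.1⟫_ℝ :=
    rfl
  have n : ⟪u, u⟫_ℝ = ⟪H1.toL2 u.1, H1.toL2 u.1⟫_ℝ + ⟪H1.grad u.1, H1.grad u.1⟫_ℝ := rfl
  rw [e, mul_assoc, ← real_inner_self_eq_norm_mul_norm, n]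
  simp only [real_inner_self_eq_norm_sq]
  rw [div_mul_eq_mul_div, div_le_iff₀ (by positivity)]
  nlinarith [mul_le_mul_of_nonneg_left (poincare hΩ u) (show 0 ≤ 1 + k ^ 2 by positivity)]

/-- The linear form `v ↦ ∫ f v` as a bounded functional. -/
def loadL {Ω : Opens Plane} (f : L2 Ω) : H10 Ω →L[ℝ] ℝ :=
  (innerSL ℝ f).comp (H1.toL2.comp (H10 Ω).subtypeL)

lemma loadL_apply {Ω : Opens Plane} (f : L2 Ω) (v : H10 Ω) : loadL f v = load f v := by
  have e : loadL f v = ⟪f, H1.toL2 v.1⟫_ℝ := rfl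
  rw [e, L2.inner_def]
  simp [load, mul_comm]

end Waveguide

end

theorem mainTheorem10 (Ω : TopologicalSpace.Opens Waveguide.Plane)
    (hΩ : (Ω : Set Waveguide.Plane) ⊆ Waveguide.strip)
    (k : ℝ) (hk : k ∈ Set.Ioo 0 Real.pi) :
    Function.Injective (Waveguide.A Ω k) ∧
    (∃ T : Waveguide.H10 Ω ≃L[ℝ] Waveguide.H10 Ω,
      (T : Waveguide.H10 Ω →L[ℝ] Waveguide.H10 Ω) = Waveguide.A Ω k) ∧
    (∀ f : Waveguide.L2 Ω, ∃! u : Waveguide.H10 Ω,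
      ∀ v : Waveguide.H10 Ω, Waveguide.form k u v = Waveguide.load f v) := by
  have hc := Waveguide.isCoercive_formL hΩ hk
  -- The Lax–Milgram equivalence is built on the same Riesz operator that defines `A`, so the two
  -- agree definitionally.
  have hT : (hc.continuousLinearEquivOfBilin : Waveguide.H10 Ω →L[ℝ] Waveguide.H10 Ω)
      = Waveguide.A Ω k := rfl
  have hA : ∀ u, Waveguide.A Ω k u = hc.continuousLinearEquivOfBilin u := fun _ => rfl
  refine ⟨hc.continuousLinearEquivOfBilin.injective, ⟨_, hT⟩, fun f => ?_⟩
  set F := (InnerProductSpace.toDual ℝ (Waveguide.H10 Ω)).symm (Waveguide.loadL f) with hF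
  have hFv : ∀ v, ⟪F, v⟫_ℝ = Waveguide.load f v := fun v => by
    rw [hF, InnerProductSpace.toDual_symm_apply, Waveguide.loadL_apply]
  refine ⟨hc.continuousLinearEquivOfBilin.symm F, fun v => ?_, fun u hu => ?_⟩
  · rw [← Waveguide.inner_A, hA, ContinuousLinearEquiv.apply_symm_apply, hFv]
  · rw [ContinuousLinearEquiv.eq_symm_apply, ← hA]
    refine ext_inner_right ℝ fun v => ?_
    rw [Waveguide.inner_A, hFv]
    exact hu v
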